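/- \textbf{Setting.} Let $\mathcal X\subseteq\mathbb R^d$, $\theta_0\in\mathbb R^d$, $\alpha_0>0$, $0\le\underline p<\overline p\le 1$, $f:\mathbb R\to\mathbb R$, and let $P_{\mathcal X}$ be a probability measure on $\mathbb R^d$ with $P_{\mathcal X}$-almost every $x$ in $\mathcal X$. For a utility $u$ and a price $p$ put $r_u(p)=p\,f(u-\alpha_0p)$, and let $P_{\mathcal U}$ be the law of $x^\top\theta_0$ under $x\sim P_{\mathcal X}$. Assume that there are constants $B\le\tilde B<\infty$, $L_f,L_U<\infty$ and $\sigma_r>0$ such that: (A1) for all $x\in\mathcal X$ and $p\in[\underline p,\overline p]$: $x^\top\theta_0\in[-B,B]$, $x^\top\theta_0-\alpha_0p\in[-\tilde B,\tilde B]$ and $f(x^\top\theta_0-\alpha_0p)\in[0,1]$; (A2) $f$ is twice continuously differentiable on $[-\tilde B,\tilde B]$ (one-sided derivatives at the end points) with $|f|,|f'|,|f''|\le L_f$ there; and for every $u\in I$, with $I$ as in (A3), there is $p^*(u)\in(\underline p,\overline p)$ such that $r_u$ is non-decreasing on $[\underline p,p^*(u)]$, non-increasing on $[p^*(u),\overline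 p]$, and $r_u(p)\le r_u(p^*(u))-\frac{\sigma_r}{2}(p-p^*(u))^2$ for all $p\in[\underline p,\overline p]$ (thus $p^*(u)$ is the unique maximizer of $r_u$ on $[\underline p,\overline p]$, the unconstrained optimal price); (A3) the support $I$ of $P_{\mathcal U}$ is a compact interval contained in $[-B,B]$, and $P_{\mathcal U}(U)\le L_U|U|/(2B)$ for every measurable $U\subseteq[-B,B]$, where $|U|$ is Lebesgue measure. Let $$\sigma_u=\inf_{v\in[-\tilde B,\tilde B]}\big\{f'(v)-\alpha_0\overline p\,|f''(v)|\big\},\qquad M_r=\sup_{u\in I,\;p\in[\underline p,\overline p]}|r_u''(p)|,$$ where $r_u''$ is the second derivative in $p$. For $\delta_0>0$, a policy $\pi:\mathcal X\to[\underline p,\overline p]$ is $\delta_0$-utility fair ($\delta_0$-UF) if $|\pi(x)-\pi(x')|\le\delta_0|(x-x')^\top\theta_0|$ for all $x,x'\in\mathcal X$; it is optimal if it maximizes $\mathbb E_{x\sim P_{\mathcal X}}[r_{x^\top\theta_0}(\pi(x))]$ among all $\delta_0$-UF policies. \textbf{Theorem.} Assume (A1)--(A3), $\sigma_u>0$ and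 $\delta_0>0$. Let $\varpi^*$ be a real function whose restriction to $I$ is $\delta_0$-Lipschitz with values in $[\underline p,\overline p]$ and such that $\pi^*(x)=\varpi^*(x^\top\theta_0)$ is an optimal $\delta_0$-UF policy, and assume that the optimal policy is unique, in the sense that every optimal $\delta_0$-UF policy equals $\pi^*$ $P_{\mathcal X}$-almost everywhere. Then: 1. $\varpi^*$ is non-decreasing on $I$. 2. $\varpi^*$ is differentiable at Lebesgue-almost every $u\in I$; and $\varpi^*(u)=p^*(u)$ for every $u$ in the interior of $I$ at which $\varpi^*$ is differentiable with $\partial_u\varpi^*(u)<\delta_0$. 3. If moreover $\delta_0\le\sigma_u/M_r$, then there is $\pi_0\in\mathbb R$ with $\varpi^*(u)=\pi_0+\delta_0u$ for all $u\in I$; and if $0\in I$, then $\pi_0=\varpi^*(0)\in[\underline p,\overline p]$. -/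

import Mathlib

open Set MeasureTheory

/-- The data of a contextual pricing problem with `d`-dimensional contexts: a customer with context
`x` who is offered the price `p ∈ [pLow, pHigh]` has expected demand `link (⟪x, θ₀⟫ - α₀ * p)`.
The standing assumptions on these data are stated separately below. -/
structure PricingModel (d : ℕ) where
  /-- the set of contexts -/
  contexts : Set (EuclideanSpace ℝ (Fin d))
  /-- the distribution of the context of a customer -/
  contextLaw : Measure (EuclideanSpace ℝ (Fin d))
  /-- the linear model of the baseline utility -/
  θ₀ : EuclideanSpace ℝ (Fin d)
  /-- the price elasticity -/
  α₀ : ℝ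
  /-- the link function `f` -/
  link : ℝ → ℝ
  /-- the lowest admissible price -/
  pLow : ℝ
  /-- the highest admissible price -/
  pHigh : ℝ
  /-- the bound on baseline utilities -/
  B : ℝ
  /-- the bound on the arguments of the link function -/
  Btilde : ℝ

noncomputable section

namespace PricingModel

variable {d : ℕ} (M : PricingModel d)

/-- The interval of admissible prices. -/
def prices : Set ℝ := Icc M.pLow M.pHigh

/-- The interval `[-B̃, B̃]` of arguments of the link function. -/
def linkDomain : Set ℝ := Icc (-M.Btilde) M.Btilde

/-- The baseline utility `x ↦ xᵀθ₀` of a context. -/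
def utility (x : EuclideanSpace ℝ (Fin d)) : ℝ := inner ℝ x M.θ₀

/-- The distribution of the baseline utility. -/
def utilityLaw : Measure ℝ := M.contextLaw.map M.utility

/-- The (topological) support of the distribution of the baseline utility. -/
def utilityRange : Set ℝ := M.utilityLaw.support

/-- The expected revenue `r_u(p) = p f(u - α₀ p)`. -/
def revenue (u p : ℝ) : ℝ := p * M.link (u - M.α₀ * p)

/-- The unconstrained optimal price `p*(u)`: a maximizer of `r_u` over the admissible prices. -/
def optimalPrice (u : ℝ) : ℝ :=
  Classical.epsilon fun p => p ∈ M.prices ∧ IsMaxOn (M.revenue u) M.prices p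

/-- Boundedness of utilities, link arguments and expected demands (and the conventions on the
prices and on the sign of the elasticity). -/
structure Bounded : Prop where
  pLow_nonneg : 0 ≤ M.pLow
  pLow_lt_pHigh : M.pLow < M.pHigh
  pHigh_le_one : M.pHigh ≤ 1
  α₀_pos : 0 < M.α₀
  B_le_Btilde : M.B ≤ M.Btilde
  utility_mem : ∀ x ∈ M.contexts, M.utility x ∈ Icc (-M.B) M.B
  link_arg_mem : ∀ x ∈ M.contexts, ∀ p ∈ M.prices, M.utility x - M.α₀ * p ∈ M.linkDomain
  link_mem : ∀ x ∈ M.contexts, ∀ p ∈ M.prices, M.link (M.utility x - M.α₀ * p) ∈ Icc (0 : ℝ) 1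

/-- The link function is twice continuously differentiable with bounded derivatives, and for every
utility `u` in the support the revenue `r_u` is unimodal with a strictly interior maximizer `p*(u)`,
away from which it decays at least quadratically (so that the maximizer is unique). -/
structure SmoothUnimodal : Prop where
  contDiffOn : ContDiffOn ℝ 2 M.link M.linkDomain
  bounded : ∃ Lf : ℝ, ∀ v ∈ M.linkDomain, |M.link v| ≤ Lf ∧
    |derivWithin M.link M.linkDomain v| ≤ Lf ∧ |iteratedDerivWithin 2 M.link M.linkDomain v| ≤ Lf
  interior : ∀ u ∈ M.utilityRange, M.optimalPrice u ∈ Ioo M.pLow M.pHigh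
  increasing : ∀ u ∈ M.utilityRange, MonotoneOn (M.revenue u) (Icc M.pLow (M.optimalPrice u))
  decreasing : ∀ u ∈ M.utilityRange, AntitoneOn (M.revenue u) (Icc (M.optimalPrice u) M.pHigh)
  decay : ∃ σr : ℝ, 0 < σr ∧ ∀ u ∈ M.utilityRange, ∀ p ∈ M.prices,
    M.revenue u p ≤ M.revenue u (M.optimalPrice u) - σr / 2 * (p - M.optimalPrice u) ^ 2

/-- The contexts are distributed on the context set, the baseline utility is supported on a compact
interval contained in `[-B, B]`, and its distribution has density at most `L_U / (2B)`. -/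
structure Stochastic : Prop where
  isProbabilityMeasure : IsProbabilityMeasure M.contextLaw
  ae_mem : ∀ᵐ x ∂M.contextLaw, x ∈ M.contexts
  support_eq : ∃ a b : ℝ, a ≤ b ∧ M.utilityRange = Icc a b ∧ Icc a b ⊆ Icc (-M.B) M.B
  density : ∃ LU : ℝ, ∀ U : Set ℝ, MeasurableSet U → U ⊆ Icc (-M.B) M.B →
    M.utilityLaw U ≤ ENNReal.ofReal (LU / (2 * M.B)) * volume U

/-- `σ_u`, the infimum of `f'(v) - α₀ p̄ |f''(v)|` over `v ∈ [-B̃, B̃]`. -/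
def sigmaU : ℝ :=
  sInf ((fun v => derivWithin M.link M.linkDomain v -
    M.α₀ * M.pHigh * |iteratedDerivWithin 2 M.link M.linkDomain v|) '' M.linkDomain)

/-- `M_r`, the supremum of `|r_u''(p)|` (second derivative in the price) over all utilities `u` in
the support and all admissible prices `p`. -/
def Mr : ℝ :=
  sSup ((fun q : ℝ × ℝ => |iteratedDerivWithin 2 (M.revenue q.1) M.prices q.2|) ''
    (M.utilityRange ×ˢ M.prices))

/-- A contextual pricing policy is `δ`-utility fair if it posts admissible prices and prices
differ by at most `δ` times the difference of the baseline utilities. -/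
def IsUtilityFair (δ : ℝ) (π : EuclideanSpace ℝ (Fin d) → ℝ) : Prop :=
  (∀ x ∈ M.contexts, π x ∈ M.prices) ∧
    ∀ x ∈ M.contexts, ∀ x' ∈ M.contexts, |π x - π x'| ≤ δ * |M.utility x - M.utility x'|

/-- The expected revenue of a contextual pricing policy. -/
def expectedRevenue (π : EuclideanSpace ℝ (Fin d) → ℝ) : ℝ :=
  ∫ x, M.revenue (M.utility x) (π x) ∂M.contextLaw

/-- `π` maximizes the expected revenue among all `δ`-utility fair policies. -/
def IsOptimalFair (δ : ℝ) (π : EuclideanSpace ℝ (Fin d) → ℝ) : Prop :=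
  M.IsUtilityFair δ π ∧
    ∀ π', M.IsUtilityFair δ π' → M.expectedRevenue π' ≤ M.expectedRevenue π

/-- The class of admissible `δ`-Lipschitz functions of the baseline utility. -/
def fairClass (δ : ℝ) : Set (ℝ → ℝ) :=
  {g | (∀ u ∈ M.utilityRange, g u ∈ M.prices) ∧
    ∀ u ∈ M.utilityRange, ∀ u' ∈ M.utilityRange, |g u - g u'| ≤ δ * |u - u'|}

end PricingModel

end

/-!
A price function `ϖ` that is the essentially unique optimum is rigid: since revenue is unimodal,
every `δ₀`-Lipschitz function lying pointwise between the unconstrained optimal price `p*` and `ϖ`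
earns at least as much as `ϖ`, hence coincides with it. Suppose that `p*` grows at rate at least
`m ≤ δ₀`, and compare `ϖ` with the function of slope `m` to the left and `δ₀` to the right of a
point `u`. Rigidity gives, for `u ≤ v`, the alternative
`ϖ u + m (v - u) ≤ p* v` or `ϖ u + δ₀ (v - u) ≤ ϖ v`, together with its mirror image.
If `ϖ` grew slower than `m` between two points, the alternatives would force it to cross `p*` in
between, and applying them on both sides of the crossing gives a contradiction. So `ϖ` inherits
every growth rate `m ≤ δ₀` of `p*`: `m = 0` yields monotonicity, and `m = δ₀` yields affinity. Where
`ϖ` differs from `p*`, the alternative with `m = 0` forces a one-sided slope of at least `δ₀`.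
The growth rate `σ_u / M_r` of `p*` comes from the first-order condition: the marginal revenue grows
at rate at least `σ_u` in the utility and at most `M_r` in the price.
-/

open Filter Topology
open scoped NNReal

/-! ### Growth rates and Lipschitz functions -/

/-- The function `f` grows at rate at least `m` on `s`. -/
def HasGrowthOn (m : ℝ) (f : ℝ → ℝ) (s : Set ℝ) : Prop :=
  ∀ ⦃u⦄, u ∈ s → ∀ ⦃v⦄, v ∈ s → u ≤ v → m * (v - u) ≤ f v - f u

section Growth

variable {m m' c : ℝ} {f f' : ℝ → ℝ} {s : Set ℝ} {K : ℝ≥0}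

theorem hasGrowthOn_zero_iff_monotoneOn : HasGrowthOn 0 f s ↔ MonotoneOn f s := by
  simp only [HasGrowthOn, MonotoneOn, zero_mul, sub_nonneg]

theorem HasGrowthOn.mono_rate (h : HasGrowthOn m f s) (hm : m' ≤ m) : HasGrowthOn m' f s :=
  fun _ hu _ hv huv =>
    (mul_le_mul_of_nonneg_right hm (sub_nonneg.mpr huv)).trans (h hu hv huv)

theorem HasGrowthOn.reflect (h : HasGrowthOn m f s) :
    HasGrowthOn m (fun u => -f (-u)) (Neg.neg ⁻¹' s) := by
  intro u hu v hv huv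
  linarith [h hv hu (neg_le_neg huv)]

theorem hasGrowthOn_of_le_hasDerivWithinAt (hs : Convex ℝ s)
    (hf : ∀ u ∈ s, HasDerivWithinAt f (f' u) s u) (hm : ∀ u ∈ s, m ≤ f' u) :
    HasGrowthOn m f s := by
  have hd : ∀ u ∈ s, HasDerivWithinAt (fun u => f u - m * u) (f' u - m) s u := fun u hu => by
    have := (hf u hu).sub ((hasDerivWithinAt_id u s).const_mul m)
    rwa [mul_one] at this
  have hmono : MonotoneOn (fun u => f u - m * u) s :=
    monotoneOn_of_hasDerivWithinAt_nonneg hs (fun u hu => (hd u hu).continuousWithinAt)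
      (fun u hu => (hd u (interior_subset hu)).mono interior_subset)
      (fun u hu => sub_nonneg.mpr (hm u (interior_subset hu)))
  intro u hu v hv huv
  linarith [hmono hu hv huv]

theorem exists_eq_add_mul_of_hasGrowthOn (hf : LipschitzOnWith K f s) (hK : HasGrowthOn K f s) :
    ∃ c, ∀ u ∈ s, f u = c + K * u := by
  have hslope : ∀ u ∈ s, ∀ v ∈ s, u ≤ v → f v - f u = K * (v - u) := fun u hu v hv huv => by
    refine le_antisymm ((le_abs_self _).trans ?_) (hK hu hv huv)
    simpa only [Real.dist_eq, abs_of_nonneg (sub_nonneg.mpr huv)] using hf.dist_le_mul v hv u hu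
  rcases s.eq_empty_or_nonempty with rfl | ⟨t, ht⟩
  · exact ⟨0, by simp⟩
  · refine ⟨f t - K * t, fun u hu => ?_⟩
    rcases le_total t u with htu | hut
    · linarith [hslope t ht u hu htu]
    · linarith [hslope u hu t ht hut]

theorem lipschitzWith_add_mul_sub (hm : |m| ≤ K) (c t : ℝ) :
    LipschitzWith K fun u => c + m * (u - t) := by
  refine LipschitzWith.of_dist_le_mul fun u v => ?_
  rw [Real.dist_eq, Real.dist_eq,
    show c + m * (u - t) - (c + m * (v - t)) = m * (u - v) by ring, abs_mul]
  gcongr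

theorem lipschitzOnWith_reflect (hf : LipschitzOnWith K f s) :
    LipschitzOnWith K (fun u => -f (-u)) (Neg.neg ⁻¹' s) :=
  LipschitzOnWith.of_dist_le_mul fun u hu v hv => by
    simpa only [dist_neg_neg] using hf.dist_le_mul (-u) hu (-v) hv

theorem exists_lipschitzWith_eqOn_forall_mem_Icc {X : Type*} [PseudoMetricSpace X] {f : X → ℝ}
    {s : Set X} {a b : ℝ} (hab : a ≤ b) (hf : LipschitzOnWith K f s) (hfs : MapsTo f s (Icc a b)) :
    ∃ g : X → ℝ, LipschitzWith K g ∧ (∀ x, g x ∈ Icc a b) ∧ EqOn f g s := by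
  obtain ⟨g, hg, hfg⟩ := hf.extend_real
  refine ⟨fun x => max a (min b (g x)), (hg.const_min b).const_max a,
    fun x => ⟨le_max_left _ _, max_le hab (min_le_left _ _)⟩, fun x hx => ?_⟩
  have hx' := hfs hx
  rw [hfg hx] at hx'
  simp only [hfg hx, min_eq_right hx'.2, max_eq_right hx'.1]

theorem ae_differentiableAt_of_lipschitzOnWith (hs : Convex ℝ s) (hf : LipschitzOnWith K f s) :
    ∀ᵐ u ∂volume.restrict s, DifferentiableAt ℝ f u := by
  have hint : interior s =ᵐ[volume] s := interior_ae_eq_of_null_frontier (hs.addHaar_frontier _)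
  rw [← Measure.restrict_congr_set hint, ae_restrict_iff' isOpen_interior.measurableSet]
  filter_upwards [hf.ae_differentiableWithinAt_of_mem_real] with u hd hu
  exact (hd (interior_subset hu)).differentiableAt (mem_interior_iff_mem_nhds.mp hu)

end Growth

/-! ### Rigid functions -/

/-- `ϖ` is rigid relative to `q` on `s`: it is `K`-Lipschitz on `s`, and it is the only
`K`-Lipschitz function lying pointwise between `q` and `ϖ`. An essentially unique optimal price
function is rigid relative to the unconstrained optimal price. -/
structure IsRigid (s : Set ℝ) (K : ℝ≥0) (q ϖ : ℝ → ℝ) : Prop where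
  lipschitzOnWith : LipschitzOnWith K ϖ s
  eqOn_of_mem_uIcc : ∀ ⦃g : ℝ → ℝ⦄, LipschitzOnWith K g s →
    (∀ u ∈ s, g u ∈ uIcc (q u) (ϖ u)) → EqOn g ϖ s

namespace IsRigid

variable {s : Set ℝ} {K : ℝ≥0} {q ϖ β : ℝ → ℝ} {m u v D : ℝ}

theorem sub_le (h : IsRigid s K q ϖ) (hu : u ∈ s) (hv : v ∈ s) (huv : u ≤ v) :
    ϖ v - ϖ u ≤ K * (v - u) := by
  refine (le_abs_self _).trans ?_
  simpa only [Real.dist_eq, abs_of_nonneg (sub_nonneg.mpr huv)] using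
    h.lipschitzOnWith.dist_le_mul v hv u hu

theorem reflect (h : IsRigid s K q ϖ) :
    IsRigid (Neg.neg ⁻¹' s) K (fun u => -q (-u)) (fun u => -ϖ (-u)) where
  lipschitzOnWith := lipschitzOnWith_reflect h.lipschitzOnWith
  eqOn_of_mem_uIcc g hg hgm u hu := by
    have hs : Neg.neg ⁻¹' (Neg.neg ⁻¹' s) = s := by ext; simp
    have hmem : ∀ w ∈ s, -g (-w) ∈ uIcc (q w) (ϖ w) := fun w hw => by
      simpa only [image_neg_uIcc, neg_neg] using
        mem_image_of_mem Neg.neg (hgm (-w) (by simpa using hw))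
    have hw := h.eqOn_of_mem_uIcc (hs ▸ lipschitzOnWith_reflect hg) hmem hu
    simpa [neg_eq_iff_eq_neg] using hw

theorem le_of_lipschitzOnWith (h : IsRigid s K q ϖ) (hβ : LipschitzOnWith K β s)
    (hqβ : ∀ w ∈ s, β w < ϖ w → q w ≤ β w) (hu : u ∈ s) : ϖ u ≤ β u := by
  have hmin : LipschitzOnWith K (fun w => min (ϖ w) (β w)) s := by
    have := h.lipschitzOnWith.to_restrict.min hβ.to_restrict
    rw [max_self] at this
    exact lipschitzOnWith_iff_restrict.mpr this
  refine min_eq_left_iff.mp (h.eqOn_of_mem_uIcc hmin (fun w hw => ?_) hu)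
  rcases le_or_gt (ϖ w) (β w) with hle | hlt
  · simp only [min_eq_left hle, right_mem_uIcc]
  · simpa only [min_eq_right hlt.le] using mem_uIcc_of_le (hqβ w hw hlt) hlt.le

theorem add_mul_sub_le_or (h : IsRigid s K q ϖ) (hm : |m| ≤ K) (hq : HasGrowthOn m q s)
    (hu : u ∈ s) (hv : v ∈ s) :
    ϖ u + m * (v - u) ≤ q v ∨ ϖ u + K * (v - u) ≤ ϖ v := by
  -- the least height at which a kink at `u` clears `q` up to `v` and `ϖ` from `v` on
  set c := max (q v - m * (v - u)) (ϖ v - K * (v - u)) with hc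
  have hβ : LipschitzWith K fun w => max (c + m * (w - u)) (c + K * (w - u)) := by
    simpa only [max_self] using (lipschitzWith_add_mul_sub hm c u).max
      (lipschitzWith_add_mul_sub (NNReal.abs_eq K).le c u)
  have hle := h.le_of_lipschitzOnWith hβ.lipschitzOnWith (fun w hw hlt => ?_) hu
  · simp only [sub_self, mul_zero, add_zero, max_self, hc, le_max_iff] at hle
    exact hle.imp (fun _ => by linarith) (fun _ => by linarith)
  · rcases le_total w v with hwv | hvw
    · refine le_max_of_le_left ?_
      linarith [hq hw hv hwv, le_max_left (q v - m * (v - u)) (ϖ v - K * (v - u))]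
    · have := (le_max_right _ _).trans_lt hlt
      linarith [h.sub_le hv hw hvw, le_max_right (q v - m * (v - u)) (ϖ v - K * (v - u))]

theorem le_sub_mul_sub_or (h : IsRigid s K q ϖ) (hm : |m| ≤ K) (hq : HasGrowthOn m q s)
    (hu : u ∈ s) (hv : v ∈ s) :
    q u + m * (v - u) ≤ ϖ v ∨ ϖ u + K * (v - u) ≤ ϖ v := by
  have := h.reflect.add_mul_sub_le_or hm hq.reflect (u := -v) (v := -u) (by simpa using hv)
    (by simpa using hu)
  simp only [neg_neg] at this
  exact this.imp (fun _ => by linarith) (fun _ => by linarith)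

theorem hasGrowthOn (h : IsRigid s K q ϖ) (hs : s.OrdConnected) (hm : |m| ≤ K)
    (hq : HasGrowthOn m q s) (hqc : ContinuousOn q s) : HasGrowthOn m ϖ s := by
  have hmK : ∀ ⦃u v : ℝ⦄, u ≤ v → m * (v - u) ≤ K * (v - u) := fun u v huv =>
    mul_le_mul_of_nonneg_right ((le_abs_self m).trans hm) (sub_nonneg.mpr huv)
  intro u hu v hv huv
  by_contra! hlt
  have hqu : q u ≤ ϖ u := by
    rcases h.le_sub_mul_sub_or hm hq hu hv with hle | hle <;> linarith [hmK huv]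
  have hqv : ϖ v ≤ q v := by
    rcases h.add_mul_sub_le_or hm hq hu hv with hle | hle <;> linarith [hmK huv]
  have huvs : Icc u v ⊆ s := hs.out hu hv
  obtain ⟨w, hw, hqw⟩ : ∃ w ∈ Icc u v, q w = ϖ w :=
    isPreconnected_Icc.intermediate_value₂ (left_mem_Icc.mpr huv) (right_mem_Icc.mpr huv)
      (hqc.mono huvs) (h.lipschitzOnWith.continuousOn.mono huvs) hqu hqv
  have hleft : ϖ u + m * (w - u) ≤ ϖ w := by
    rcases h.add_mul_sub_le_or hm hq hu (huvs hw) with hle | hle <;> linarith [hmK hw.1]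
  have hright : ϖ w + m * (v - w) ≤ ϖ v := by
    rcases h.le_sub_mul_sub_or hm hq (huvs hw) hv with hle | hle <;> linarith [hmK hw.2]
  linarith

theorem le_of_hasDerivAt_lt (h : IsRigid s K q ϖ) (hq : MonotoneOn q s) (hqc : ContinuousOn q s)
    (hs : s ∈ 𝓝 u) (hd : HasDerivAt ϖ D u) (hD : D < K) : ϖ u ≤ q u := by
  by_contra! hlt
  refine hD.not_ge ?_
  have hslope : Tendsto (slope ϖ u) (𝓝[>] u) (𝓝 D) :=
    (hasDerivWithinAt_iff_tendsto_slope' self_notMem_Ioi).mp hd.hasDerivWithinAt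
  refine ge_of_tendsto hslope ?_
  filter_upwards [self_mem_nhdsWithin, nhdsWithin_le_nhds hs,
    nhdsWithin_le_nhds ((hqc.continuousAt hs).eventually_lt_const hlt)] with v huv hv hqv
  have hle := (h.add_mul_sub_le_or (m := 0) (by simp) (hasGrowthOn_zero_iff_monotoneOn.mpr hq)
    (mem_of_mem_nhds hs) hv).resolve_left (by linarith)
  rw [slope_def_field, le_div_iff₀ (sub_pos.mpr huv)]
  linarith

theorem eq_of_hasDerivAt_lt (h : IsRigid s K q ϖ) (hq : MonotoneOn q s) (hqc : ContinuousOn q s)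
    (hs : s ∈ 𝓝 u) (hd : HasDerivAt ϖ D u) (hD : D < K) : ϖ u = q u := by
  refine le_antisymm (h.le_of_hasDerivAt_lt hq hqc hs hd hD) ?_
  have hd' : HasDerivAt (fun w => -ϖ (-w)) D (-u) := by
    have hdu : HasDerivAt ϖ D (-(-u)) := by rwa [neg_neg]
    have := (hdu.comp (-u) (hasDerivAt_neg (-u))).neg
    rwa [mul_neg_one, neg_neg] at this
  have hle := h.reflect.le_of_hasDerivAt_lt (u := -u)
    (hasGrowthOn_zero_iff_monotoneOn.mp (hasGrowthOn_zero_iff_monotoneOn.mpr hq).reflect)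
    (hqc.comp continuous_neg.continuousOn fun _ hw => hw).neg
    (continuous_neg.continuousAt (by simpa using hs)) hd' hD
  simpa using hle

end IsRigid

/-! ### Unimodal functions -/

/-- `r` is unimodal on `P` with peak `q`: it increases up to `q`, decreases from `q` on, and
attains its maximum over `P` only at `q`. -/
structure IsUnimodalOn {α β : Type*} [LinearOrder α] [Preorder β] (r : α → β) (P : Set α) (q : α) :
    Prop where
  mem : q ∈ P
  monotoneOn : MonotoneOn r (P ∩ Iic q)
  antitoneOn : AntitoneOn r (P ∩ Ici q)
  lt_peak : ∀ ⦃p⦄, p ∈ P → p ≠ q → r p < r q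

namespace IsUnimodalOn

section Order

variable {α β : Type*} [LinearOrder α] [Preorder β] {r : α → β} {P : Set α} {p p' q : α}

theorem le_of_mem_uIcc (h : IsUnimodalOn r P q) (hP : P.OrdConnected) (hp : p ∈ P)
    (hp' : p' ∈ uIcc q p) : r p ≤ r p' := by
  have hp'P : p' ∈ P := hP.uIcc_subset h.mem hp hp'
  rcases mem_uIcc.mp hp' with ⟨hqp', hp'p⟩ | ⟨hpp', hp'q⟩
  · exact h.antitoneOn ⟨hp'P, hqp'⟩ ⟨hp, hqp'.trans hp'p⟩ hp'p
  · exact h.monotoneOn ⟨hp, hpp'.trans hp'q⟩ ⟨hp'P, hp'q⟩ hpp'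

end Order

section Topology

variable {X α β : Type*} [TopologicalSpace X] [LinearOrder α] [TopologicalSpace α] [OrderTopology α]
  [LinearOrder β] [TopologicalSpace β] [OrderClosedTopology β] {r : X → α → β} {s : Set X}
  {P : Set α} {q : X → α}

theorem continuousOn_peak (hP : P.OrdConnected) (hr : ∀ p ∈ P, ContinuousOn (fun x => r x p) s)
    (hq : ∀ x ∈ s, IsUnimodalOn (r x) P (q x)) : ContinuousOn q s := by
  intro x hx
  have hbetter : ∀ a ∈ P, a ≠ q x → ∀ᶠ y in 𝓝[s] x, r y a < r y (q x) := fun a ha hne =>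
    (hr a ha x hx).eventually_lt (hr (q x) (hq x hx).mem x hx) ((hq x hx).lt_peak ha hne)
  refine tendsto_order.mpr ⟨fun a ha => ?_, fun a ha => ?_⟩
  · by_cases haP : a ∈ P
    · filter_upwards [self_mem_nhdsWithin, hbetter a haP ha.ne] with y hy hlt
      by_contra! hle
      exact hlt.not_ge ((hq y hy).antitoneOn ⟨haP, hle⟩ ⟨(hq x hx).mem, hle.trans ha.le⟩ ha.le)
    · filter_upwards [self_mem_nhdsWithin] with y hy
      by_contra! hle
      exact haP (hP.out (hq y hy).mem (hq x hx).mem ⟨hle, ha.le⟩)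
  · by_cases haP : a ∈ P
    · filter_upwards [self_mem_nhdsWithin, hbetter a haP ha.ne'] with y hy hlt
      by_contra! hle
      exact hlt.not_ge ((hq y hy).monotoneOn ⟨(hq x hx).mem, ha.le.trans hle⟩ ⟨haP, hle⟩ ha.le)
    · filter_upwards [self_mem_nhdsWithin] with y hy
      by_contra! hle
      exact haP (hP.out (hq x hx).mem (hq y hy).mem ⟨ha.le, hle⟩)

end Topology

section Deriv

variable {r : ℝ → ℝ} {P : Set ℝ} {p q r' : ℝ}

theorem hasDerivAt_eq_zero (h : IsUnimodalOn r P q) (hP : P ∈ 𝓝 q) (hr : HasDerivAt r r' q) :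
    r' = 0 := by
  have hmax : IsLocalMax r q := by
    filter_upwards [hP] with p hp
    rcases eq_or_ne p q with rfl | hne
    · exact le_rfl
    · exact (h.lt_peak hp hne).le
  exact hmax.hasDerivAt_eq_zero hr

theorem lt_peak_of_hasDerivAt_pos (h : IsUnimodalOn r P q) (hP : P ∈ 𝓝 p) (hr : HasDerivAt r r' p)
    (hr' : 0 < r') : p < q := by
  by_contra! hqp
  have hanti : AntitoneOn r (Ici p ∩ P) :=
    h.antitoneOn.mono fun _ hp => ⟨hp.2, hqp.trans hp.1⟩
  have hderiv : derivWithin r (Ici p ∩ P) p = r' :=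
    hr.hasDerivWithinAt.derivWithin ((uniqueDiffWithinAt_Ici p).inter hP)
  exact (hderiv ▸ hanti.derivWithin_nonpos).not_gt hr'

end Deriv

end IsUnimodalOn

/-! ### The pricing model -/

namespace PricingModel

variable {d : ℕ} {M : PricingModel d} {K : ℝ≥0} {g h ϖ : ℝ → ℝ}

theorem measurable_utility : Measurable M.utility :=
  (continuous_id.inner continuous_const).measurable

theorem ae_utility_mem_utilityRange : ∀ᵐ x ∂M.contextLaw, M.utility x ∈ M.utilityRange :=
  ae_of_ae_map measurable_utility.aemeasurable (Measure.support_mem_ae (μ := M.utilityLaw))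

theorem utilityRange_subset_of_isClosed {C : Set ℝ} (hC : IsClosed C)
    (h : ∀ᵐ x ∂M.contextLaw, M.utility x ∈ C) : M.utilityRange ⊆ C :=
  Measure.support_subset_of_isClosed hC
    ((ae_map_iff measurable_utility.aemeasurable hC.measurableSet).mpr h)

theorem mem_fairClass_iff :
    g ∈ M.fairClass K ↔ MapsTo g M.utilityRange M.prices ∧ LipschitzOnWith K g M.utilityRange := by
  simp only [fairClass, mem_ofPred_eq, MapsTo, lipschitzOnWith_iff_dist_le_mul, Real.dist_eq]

theorem isUtilityFair_comp_utility (hg : LipschitzWith K g) (hgp : ∀ u, g u ∈ M.prices) :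
    M.IsUtilityFair K (fun x => g (M.utility x)) :=
  ⟨fun _ _ => hgp _, fun x _ x' _ => by
    simpa only [Real.dist_eq] using hg.dist_le_mul (M.utility x) (M.utility x')⟩

theorem integrable_comp_utility [IsFiniteMeasure M.contextLaw] (hI : IsCompact M.utilityRange)
    (hg : ContinuousOn g M.utilityRange) :
    Integrable (fun x => g (M.utility x)) M.contextLaw := by
  have : IsFiniteMeasure M.utilityLaw :=
    inferInstanceAs (IsFiniteMeasure (M.contextLaw.map M.utility))
  have hint : IntegrableOn g M.utilityRange M.utilityLaw := hg.integrableOn_compact hI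
  have hrestrict : M.utilityLaw.restrict M.utilityRange = M.utilityLaw :=
    Measure.restrict_eq_self_of_ae_mem Measure.support_mem_ae
  rw [IntegrableOn, hrestrict] at hint
  exact hint.comp_measurable measurable_utility

/-- The derivative `f'` of the link function on `[-B̃, B̃]`, one-sided at the end points. -/
noncomputable def linkDeriv (M : PricingModel d) : ℝ → ℝ :=
  derivWithin M.link M.linkDomain

/-- The second derivative `f''` of the link function on `[-B̃, B̃]`, one-sided at the end points. -/
noncomputable def linkDeriv₂ (M : PricingModel d) : ℝ → ℝ :=
  iteratedDerivWithin 2 M.link M.linkDomain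

/-- The marginal revenue `∂ₚ r_u(p)`. -/
noncomputable def marginalRevenue (M : PricingModel d) (u p : ℝ) : ℝ :=
  M.link (u - M.α₀ * p) - M.α₀ * p * M.linkDeriv (u - M.α₀ * p)

/-- The second derivative `∂ₚ² r_u(p)` of the revenue in the price. -/
noncomputable def revenueCurvature (M : PricingModel d) (u p : ℝ) : ℝ :=
  M.α₀ ^ 2 * p * M.linkDeriv₂ (u - M.α₀ * p) - 2 * M.α₀ * M.linkDeriv (u - M.α₀ * p)

/-- The regularity of a pricing model on which the structure of its fair optimal prices rests:
utilities range over an interval, the link function is twice continuously differentiable on an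
interval containing all its arguments, and revenues are unimodal with an interior peak. -/
structure Regular (M : PricingModel d) : Prop where
  pLow_nonneg : 0 ≤ M.pLow
  α₀_pos : 0 < M.α₀
  nonempty_utilityRange : M.utilityRange.Nonempty
  ordConnected_utilityRange : M.utilityRange.OrdConnected
  link_arg_mem : ∀ ⦃u⦄, u ∈ M.utilityRange → ∀ ⦃p⦄, p ∈ M.prices → u - M.α₀ * p ∈ M.linkDomain
  contDiffOn : ContDiffOn ℝ 2 M.link M.linkDomain
  optimalPrice_mem_Ioo : ∀ ⦃u⦄, u ∈ M.utilityRange → M.optimalPrice u ∈ Ioo M.pLow M.pHigh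
  unimodal : ∀ ⦃u⦄, u ∈ M.utilityRange →
    IsUnimodalOn (M.revenue u) M.prices (M.optimalPrice u)

theorem regular (hB : M.Bounded) (hU : M.SmoothUnimodal) (hS : M.Stochastic) : M.Regular where
  pLow_nonneg := hB.pLow_nonneg
  α₀_pos := hB.α₀_pos
  nonempty_utilityRange := by
    obtain ⟨a, b, hab, hI, -⟩ := hS.support_eq
    exact hI ▸ nonempty_Icc.mpr hab
  ordConnected_utilityRange := by
    obtain ⟨a, b, -, hI, -⟩ := hS.support_eq
    exact hI ▸ ordConnected_Icc
  link_arg_mem u hu p hp := by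
    have hclosed : IsClosed ((fun u => u - M.α₀ * p) ⁻¹' M.linkDomain) :=
      isClosed_Icc.preimage (by fun_prop)
    exact utilityRange_subset_of_isClosed hclosed
      (hS.ae_mem.mono fun x hx => hB.link_arg_mem x hx p hp) hu
  contDiffOn := hU.contDiffOn
  optimalPrice_mem_Ioo := hU.interior
  unimodal u hu :=
    { mem := Ioo_subset_Icc_self (hU.interior u hu)
      monotoneOn := (hU.increasing u hu).mono fun _ hp => ⟨hp.1.1, hp.2⟩
      antitoneOn := (hU.decreasing u hu).mono fun _ hp => ⟨hp.2, hp.1.2⟩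
      lt_peak := fun p hp hne => by
        obtain ⟨σr, hσr, hdecay⟩ := hU.decay
        have := mul_pos (half_pos hσr) (sq_pos_of_ne_zero (sub_ne_zero.mpr hne))
        linarith [hdecay u hu p hp] }

namespace Regular

variable {u v p p' : ℝ}

theorem pLow_lt_pHigh (hM : M.Regular) : M.pLow < M.pHigh := by
  obtain ⟨u, hu⟩ := hM.nonempty_utilityRange
  exact (hM.optimalPrice_mem_Ioo hu).1.trans (hM.optimalPrice_mem_Ioo hu).2

theorem optimalPrice_mem (hM : M.Regular) (hu : u ∈ M.utilityRange) :
    M.optimalPrice u ∈ M.prices :=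
  (hM.unimodal hu).mem

theorem prices_mem_nhds_optimalPrice (hM : M.Regular) (hu : u ∈ M.utilityRange) :
    M.prices ∈ 𝓝 (M.optimalPrice u) :=
  Icc_mem_nhds (hM.optimalPrice_mem_Ioo hu).1 (hM.optimalPrice_mem_Ioo hu).2

theorem uniqueDiffOn_linkDomain (hM : M.Regular) : UniqueDiffOn ℝ M.linkDomain := by
  obtain ⟨u, hu⟩ := hM.nonempty_utilityRange
  have hlow := hM.link_arg_mem hu (left_mem_Icc.mpr hM.pLow_lt_pHigh.le)
  have hhigh := hM.link_arg_mem hu (right_mem_Icc.mpr hM.pLow_lt_pHigh.le)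
  have hlt := mul_lt_mul_of_pos_left hM.pLow_lt_pHigh hM.α₀_pos
  exact uniqueDiffOn_Icc (by linarith [hlow.2, hhigh.1])

theorem isCompact_utilityRange (hM : M.Regular) : IsCompact M.utilityRange := by
  refine Metric.isCompact_of_isClosed_isBounded Measure.isClosed_support
    ((Metric.isBounded_Icc (-M.Btilde + M.α₀ * M.pLow) (M.Btilde + M.α₀ * M.pLow)).subset
      fun u hu => ?_)
  have hlow := hM.link_arg_mem hu (left_mem_Icc.mpr hM.pLow_lt_pHigh.le)
  exact ⟨by linarith [hlow.1], by linarith [hlow.2]⟩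

theorem continuousOn_linkDeriv (hM : M.Regular) : ContinuousOn M.linkDeriv M.linkDomain :=
  hM.contDiffOn.continuousOn_derivWithin hM.uniqueDiffOn_linkDomain one_le_two

theorem continuousOn_linkDeriv₂ (hM : M.Regular) : ContinuousOn M.linkDeriv₂ M.linkDomain :=
  hM.contDiffOn.continuousOn_iteratedDerivWithin le_rfl hM.uniqueDiffOn_linkDomain

theorem hasDerivWithinAt_link (hM : M.Regular) (hv : v ∈ M.linkDomain) :
    HasDerivWithinAt M.link (M.linkDeriv v) M.linkDomain v :=
  (hM.contDiffOn.differentiableOn two_ne_zero v hv).hasDerivWithinAt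

theorem hasDerivWithinAt_linkDeriv (hM : M.Regular) (hv : v ∈ M.linkDomain) :
    HasDerivWithinAt M.linkDeriv (M.linkDeriv₂ v) M.linkDomain v := by
  have hderiv : M.linkDeriv₂ v = derivWithin M.linkDeriv M.linkDomain v := by
    rw [linkDeriv₂, iteratedDerivWithin_succ, iteratedDerivWithin_one, linkDeriv]
  have hdiff : DifferentiableOn ℝ M.linkDeriv M.linkDomain :=
    (hM.contDiffOn.derivWithin hM.uniqueDiffOn_linkDomain one_add_one_eq_two.le).differentiableOn
      one_ne_zero
  exact hderiv ▸ (hdiff v hv).hasDerivWithinAt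

theorem continuousOn_revenue (hM : M.Regular) (hg : ContinuousOn g M.utilityRange)
    (hgp : MapsTo g M.utilityRange M.prices) :
    ContinuousOn (fun u => M.revenue u (g u)) M.utilityRange :=
  hg.mul (hM.contDiffOn.continuousOn.comp (continuousOn_id.sub (continuousOn_const.mul hg))
    fun _ hu => hM.link_arg_mem hu (hgp hu))

theorem hasDerivWithinAt_comp_link_arg (hM : M.Regular) {k : ℝ → ℝ} {k' : ℝ}
    (hu : u ∈ M.utilityRange) (hk : HasDerivWithinAt k k' M.linkDomain (u - M.α₀ * p)) :
    HasDerivWithinAt (fun p => k (u - M.α₀ * p)) (-(M.α₀ * k')) M.prices p := by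
  have harg : HasDerivWithinAt (fun p => u - M.α₀ * p) (-(M.α₀ * 1)) M.prices p :=
    ((hasDerivWithinAt_id p M.prices).const_mul M.α₀).const_sub u
  exact (hk.comp p harg fun _ hp' => hM.link_arg_mem hu hp').congr_deriv (by ring)

theorem hasDerivWithinAt_revenue (hM : M.Regular) (hu : u ∈ M.utilityRange) (hp : p ∈ M.prices) :
    HasDerivWithinAt (M.revenue u) (M.marginalRevenue u p) M.prices p := by
  have := (hasDerivWithinAt_id p M.prices).mul
    (hM.hasDerivWithinAt_comp_link_arg hu (hM.hasDerivWithinAt_link (hM.link_arg_mem hu hp)))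
  refine this.congr_deriv ?_
  simp only [marginalRevenue, id]
  ring

theorem hasDerivWithinAt_marginalRevenue (hM : M.Regular) (hu : u ∈ M.utilityRange)
    (hp : p ∈ M.prices) :
    HasDerivWithinAt (M.marginalRevenue u) (M.revenueCurvature u p) M.prices p := by
  have harg := hM.link_arg_mem hu hp
  have := (hM.hasDerivWithinAt_comp_link_arg hu (hM.hasDerivWithinAt_link harg)).sub
    (((hasDerivWithinAt_id p M.prices).const_mul M.α₀).mul
      (hM.hasDerivWithinAt_comp_link_arg hu (hM.hasDerivWithinAt_linkDeriv harg)))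
  refine this.congr_deriv ?_
  simp only [revenueCurvature, id]
  ring

theorem iteratedDerivWithin_two_revenue (hM : M.Regular) (hu : u ∈ M.utilityRange)
    (hp : p ∈ M.prices) :
    iteratedDerivWithin 2 (M.revenue u) M.prices p = M.revenueCurvature u p := by
  have hud : UniqueDiffOn ℝ M.prices := uniqueDiffOn_Icc hM.pLow_lt_pHigh
  have heq : EqOn (derivWithin (M.revenue u) M.prices) (M.marginalRevenue u) M.prices :=
    fun p hp => (hM.hasDerivWithinAt_revenue hu hp).derivWithin (hud p hp)
  rw [iteratedDerivWithin_succ, iteratedDerivWithin_one, derivWithin_congr heq (heq hp)]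
  exact (hM.hasDerivWithinAt_marginalRevenue hu hp).derivWithin (hud p hp)

theorem abs_revenueCurvature_le_Mr (hM : M.Regular) (hu : u ∈ M.utilityRange)
    (hp : p ∈ M.prices) : |M.revenueCurvature u p| ≤ M.Mr := by
  have harg : MapsTo (fun z : ℝ × ℝ => z.1 - M.α₀ * z.2) (M.utilityRange ×ˢ M.prices)
      M.linkDomain := fun z hz => hM.link_arg_mem hz.1 hz.2
  have hargc : ContinuousOn (fun z : ℝ × ℝ => z.1 - M.α₀ * z.2) (M.utilityRange ×ˢ M.prices) := by
    fun_prop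
  have hcont : ContinuousOn (fun z : ℝ × ℝ => |M.revenueCurvature z.1 z.2|)
      (M.utilityRange ×ˢ M.prices) :=
    (((continuousOn_const.mul continuousOn_snd).mul
      (hM.continuousOn_linkDeriv₂.comp hargc harg)).sub
        (continuousOn_const.mul (hM.continuousOn_linkDeriv.comp hargc harg))).abs
  have hMr : M.Mr = sSup ((fun z : ℝ × ℝ => |M.revenueCurvature z.1 z.2|) ''
      (M.utilityRange ×ˢ M.prices)) :=
    congrArg sSup (image_congr fun z hz => by
      rw [hM.iteratedDerivWithin_two_revenue hz.1 hz.2])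
  rw [hMr]
  exact le_csSup ((hM.isCompact_utilityRange.prod isCompact_Icc).bddAbove_image hcont)
    (mem_image_of_mem _ (mk_mem_prod hu hp))

theorem abs_marginalRevenue_sub_le (hM : M.Regular) (hu : u ∈ M.utilityRange) (hp : p ∈ M.prices)
    (hp' : p' ∈ M.prices) :
    |M.marginalRevenue u p' - M.marginalRevenue u p| ≤ M.Mr * |p' - p| :=
  (convex_Icc _ _).norm_image_sub_le_of_norm_hasDerivWithin_le
    (fun _ hp => hM.hasDerivWithinAt_marginalRevenue hu hp)
    (fun _ hp => hM.abs_revenueCurvature_le_Mr hu hp) hp hp'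

theorem sigmaU_le (hM : M.Regular) (hv : v ∈ M.linkDomain) (hp : p ∈ M.prices) :
    M.sigmaU ≤ M.linkDeriv v - M.α₀ * p * M.linkDeriv₂ v := by
  have hcont : ContinuousOn (fun v => M.linkDeriv v - M.α₀ * M.pHigh * |M.linkDeriv₂ v|)
      M.linkDomain :=
    hM.continuousOn_linkDeriv.sub (continuousOn_const.mul hM.continuousOn_linkDeriv₂.abs)
  have hαp : 0 ≤ M.α₀ * p := mul_nonneg hM.α₀_pos.le (hM.pLow_nonneg.trans hp.1)
  calc M.sigmaU ≤ M.linkDeriv v - M.α₀ * M.pHigh * |M.linkDeriv₂ v| :=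
        csInf_le (isCompact_Icc.bddBelow_image hcont) (mem_image_of_mem _ hv)
    _ ≤ M.linkDeriv v - M.α₀ * p * |M.linkDeriv₂ v| := by
        gcongr
        exacts [hM.α₀_pos.le, hp.2]
    _ ≤ M.linkDeriv v - M.α₀ * p * M.linkDeriv₂ v := by
        gcongr
        exact le_abs_self _

theorem hasGrowthOn_marginalRevenue (hM : M.Regular) (hp : p ∈ M.prices) :
    HasGrowthOn M.sigmaU (fun u => M.marginalRevenue u p) M.utilityRange := by
  have hlink : HasGrowthOn M.sigmaU (fun w => M.link w - M.α₀ * p * M.linkDeriv w) M.linkDomain :=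
    hasGrowthOn_of_le_hasDerivWithinAt (convex_Icc _ _)
      (fun w hw => (hM.hasDerivWithinAt_link hw).sub
        ((hM.hasDerivWithinAt_linkDeriv hw).const_mul (M.α₀ * p)))
      (fun w hw => hM.sigmaU_le hw hp)
  intro u hu v hv huv
  simpa only [marginalRevenue, sub_sub_sub_cancel_right] using
    hlink (hM.link_arg_mem hu hp) (hM.link_arg_mem hv hp) (sub_le_sub_right huv _)

theorem marginalRevenue_optimalPrice (hM : M.Regular) (hu : u ∈ M.utilityRange) :
    M.marginalRevenue u (M.optimalPrice u) = 0 :=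
  (hM.unimodal hu).hasDerivAt_eq_zero (hM.prices_mem_nhds_optimalPrice hu)
    ((hM.hasDerivWithinAt_revenue hu (hM.optimalPrice_mem hu)).hasDerivAt
      (hM.prices_mem_nhds_optimalPrice hu))

theorem sigmaU_mul_le_marginalRevenue (hM : M.Regular) (hu : u ∈ M.utilityRange)
    (hv : v ∈ M.utilityRange) (huv : u ≤ v) :
    M.sigmaU * (v - u) ≤ M.marginalRevenue v (M.optimalPrice u) := by
  simpa only [hM.marginalRevenue_optimalPrice hu, sub_zero] using
    hM.hasGrowthOn_marginalRevenue (hM.optimalPrice_mem hu) hu hv huv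

theorem strictMonoOn_optimalPrice (hM : M.Regular) (hσ : 0 < M.sigmaU) :
    StrictMonoOn M.optimalPrice M.utilityRange := fun _ hu _ hv huv =>
  (hM.unimodal hv).lt_peak_of_hasDerivAt_pos (hM.prices_mem_nhds_optimalPrice hu)
    ((hM.hasDerivWithinAt_revenue hv (hM.optimalPrice_mem hu)).hasDerivAt
      (hM.prices_mem_nhds_optimalPrice hu))
    ((mul_pos hσ (sub_pos.mpr huv)).trans_le (hM.sigmaU_mul_le_marginalRevenue hu hv huv.le))

theorem hasGrowthOn_optimalPrice (hM : M.Regular) (hσ : 0 < M.sigmaU) (hMr : 0 < M.Mr) :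
    HasGrowthOn (M.sigmaU / M.Mr) M.optimalPrice M.utilityRange := by
  intro u hu v hv huv
  have hq := (hM.strictMonoOn_optimalPrice hσ).monotoneOn hu hv huv
  rw [div_mul_eq_mul_div, div_le_iff₀' hMr]
  calc M.sigmaU * (v - u)
      ≤ M.marginalRevenue v (M.optimalPrice u) := hM.sigmaU_mul_le_marginalRevenue hu hv huv
    _ = M.marginalRevenue v (M.optimalPrice u) - M.marginalRevenue v (M.optimalPrice v) := by
        rw [hM.marginalRevenue_optimalPrice hv, sub_zero]
    _ ≤ M.Mr * |M.optimalPrice u - M.optimalPrice v| := (le_abs_self _).trans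
        (hM.abs_marginalRevenue_sub_le hv (hM.optimalPrice_mem hv) (hM.optimalPrice_mem hu))
    _ = M.Mr * (M.optimalPrice v - M.optimalPrice u) := by
        rw [abs_sub_comm, abs_of_nonneg (sub_nonneg.mpr hq)]

theorem continuousOn_optimalPrice (hM : M.Regular) : ContinuousOn M.optimalPrice M.utilityRange :=
  IsUnimodalOn.continuousOn_peak ordConnected_Icc
    (fun _ hp => hM.continuousOn_revenue continuousOn_const fun _ _ => hp)
    (fun _ hu => hM.unimodal hu)

theorem expectedRevenue_le [IsFiniteMeasure M.contextLaw] (hM : M.Regular)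
    (hg : ContinuousOn g M.utilityRange) (hgp : MapsTo g M.utilityRange M.prices)
    (hh : ContinuousOn h M.utilityRange) (hhp : MapsTo h M.utilityRange M.prices)
    (hle : ∀ u ∈ M.utilityRange, M.revenue u (g u) ≤ M.revenue u (h u)) :
    M.expectedRevenue (fun x => g (M.utility x)) ≤ M.expectedRevenue (fun x => h (M.utility x)) :=
  integral_mono_ae
    (integrable_comp_utility hM.isCompact_utilityRange (hM.continuousOn_revenue hg hgp))
    (integrable_comp_utility hM.isCompact_utilityRange (hM.continuousOn_revenue hh hhp))
    (ae_utility_mem_utilityRange.mono fun _ hx => hle _ hx)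

theorem isRigid_of_isOptimalFair [IsFiniteMeasure M.contextLaw] (hM : M.Regular)
    (hϖ : ϖ ∈ M.fairClass K) (hopt : M.IsOptimalFair K fun x => ϖ (M.utility x))
    (huniq : ∀ π, M.IsOptimalFair K π → ∀ᵐ x ∂M.contextLaw, π x = ϖ (M.utility x)) :
    IsRigid M.utilityRange K M.optimalPrice ϖ := by
  obtain ⟨hϖp, hϖL⟩ := mem_fairClass_iff.mp hϖ
  refine ⟨hϖL, fun g hg hgϖ => ?_⟩
  have hgp : MapsTo g M.utilityRange M.prices := fun u hu =>
    ordConnected_Icc.uIcc_subset (hM.optimalPrice_mem hu) (hϖp hu) (hgϖ u hu)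
  -- fairness constrains all contexts, whose utilities need not lie in the support
  obtain ⟨G, hG, hGp, hGg⟩ :=
    exists_lipschitzWith_eqOn_forall_mem_Icc hM.pLow_lt_pHigh.le hg hgp
  obtain ⟨W, hW, -, hWϖ⟩ := exists_lipschitzWith_eqOn_forall_mem_Icc hM.pLow_lt_pHigh.le hϖL hϖp
  have hle : M.expectedRevenue (fun x => ϖ (M.utility x)) ≤
      M.expectedRevenue (fun x => G (M.utility x)) :=
    hM.expectedRevenue_le hϖL.continuousOn hϖp hG.continuous.continuousOn (fun _ _ => hGp _)
      fun u hu => hGg hu ▸ (hM.unimodal hu).le_of_mem_uIcc ordConnected_Icc (hϖp hu) (hgϖ u hu)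
  have hae := huniq _ ⟨isUtilityFair_comp_utility hG hGp, fun π hπ => (hopt.2 π hπ).trans hle⟩
  have hGW : M.utilityRange ⊆ {u | G u = W u} := by
    refine utilityRange_subset_of_isClosed (isClosed_eq hG.continuous hW.continuous) ?_
    filter_upwards [hae, ae_utility_mem_utilityRange] with x hx hxI
    exact hx.trans (hWϖ hxI)
  exact fun u hu => (hGg hu).trans ((hGW hu).trans (hWϖ hu).symm)

end Regular

end PricingModel

theorem mainTheorem3_general {d : ℕ} (M : PricingModel d) (hM : M.Regular)
    [IsFiniteMeasure M.contextLaw] (hσ : 0 < M.sigmaU) (δ₀ : ℝ) (hδ₀ : 0 < δ₀)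
    (ϖ : ℝ → ℝ) (hϖ : ϖ ∈ M.fairClass δ₀)
    (hopt : M.IsOptimalFair δ₀ (fun x => ϖ (M.utility x)))
    (huniq : ∀ π, M.IsOptimalFair δ₀ π → ∀ᵐ x ∂M.contextLaw, π x = ϖ (M.utility x)) :
    MonotoneOn ϖ M.utilityRange ∧
    (∀ᵐ u ∂(volume.restrict M.utilityRange), DifferentiableAt ℝ ϖ u) ∧
    (∀ u ∈ interior M.utilityRange, DifferentiableAt ℝ ϖ u → deriv ϖ u < δ₀ →
      ϖ u = M.optimalPrice u) ∧
    (δ₀ ≤ M.sigmaU / M.Mr →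
      ∃ π₀ : ℝ, (∀ u ∈ M.utilityRange, ϖ u = π₀ + δ₀ * u) ∧
        (0 ∈ M.utilityRange → π₀ = ϖ 0 ∧ π₀ ∈ M.prices)) := by
  lift δ₀ to ℝ≥0 using hδ₀.le
  have hrigid := hM.isRigid_of_isOptimalFair hϖ hopt huniq
  have hI := hM.ordConnected_utilityRange
  have hq := (hM.strictMonoOn_optimalPrice hσ).monotoneOn
  have hqc := hM.continuousOn_optimalPrice
  refine ⟨?_, ?_, fun u hu hd hlt => ?_, fun hδM => ?_⟩
  · rw [← hasGrowthOn_zero_iff_monotoneOn] at hq ⊢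
    exact hrigid.hasGrowthOn hI (by simp) hq hqc
  · exact ae_differentiableAt_of_lipschitzOnWith hI.convex hrigid.lipschitzOnWith
  · exact hrigid.eq_of_hasDerivAt_lt hq hqc (mem_interior_iff_mem_nhds.mp hu) hd.hasDerivAt hlt
  · have hMr : 0 < M.Mr := (div_pos_iff_of_pos_left hσ).mp (hδ₀.trans_le hδM)
    have hqδ := (hM.hasGrowthOn_optimalPrice hσ hMr).mono_rate hδM
    obtain ⟨π₀, hπ₀⟩ := exists_eq_add_mul_of_hasGrowthOn hrigid.lipschitzOnWith
      (hrigid.hasGrowthOn hI (NNReal.abs_eq δ₀).le hqδ hqc)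
    refine ⟨π₀, hπ₀, fun h0 => ?_⟩
    have hπ₀0 : π₀ = ϖ 0 := by simpa using (hπ₀ 0 h0).symm
    exact ⟨hπ₀0, hπ₀0 ▸ hϖ.1 0 h0⟩

theorem mainTheorem3 {d : ℕ} (M : PricingModel d)
    (hBounded : M.Bounded) (hSmooth : M.SmoothUnimodal) (hStochastic : M.Stochastic)
    (hσ : 0 < M.sigmaU) (δ₀ : ℝ) (hδ₀ : 0 < δ₀)
    (ϖ : ℝ → ℝ) (hϖ : ϖ ∈ M.fairClass δ₀)
    (hopt : M.IsOptimalFair δ₀ (fun x => ϖ (M.utility x)))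
    (huniq : ∀ π, M.IsOptimalFair δ₀ π → ∀ᵐ x ∂M.contextLaw, π x = ϖ (M.utility x)) :
    MonotoneOn ϖ M.utilityRange ∧
    (∀ᵐ u ∂(volume.restrict M.utilityRange), DifferentiableAt ℝ ϖ u) ∧
    (∀ u ∈ interior M.utilityRange, DifferentiableAt ℝ ϖ u → deriv ϖ u < δ₀ →
      ϖ u = M.optimalPrice u) ∧
    (δ₀ ≤ M.sigmaU / M.Mr →
      ∃ π₀ : ℝ, (∀ u ∈ M.utilityRange, ϖ u = π₀ + δ₀ * u) ∧
        (0 ∈ M.utilityRange → π₀ = ϖ 0 ∧ π₀ ∈ M.prices)) := by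
  have := hStochastic.isProbabilityMeasure
  exact mainTheorem3_general M (PricingModel.regular hBounded hSmooth hStochastic) hσ δ₀ hδ₀ ϖ hϖ
    hopt huniq
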